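/- Let $n\ge r\ge 1$ be integers and write $n=q_1r+r_1$ with $0\le r_1<r$. Let $\mathcal A$ be the algebra of germs at the origin of holomorphic functions on $\mathbb C^n\times\mathbb C^r=\mathbb C^m$, $m=n+r$, with coordinates $a_0,\dots,a_{n-1},b_0,\dots,b_{r-1}$. For an ideal $J\subseteq\mathcal A$ and an integer $k\ge 0$, the Jacobian extension $\Delta_kJ$ is the ideal generated by $J$ and all $k\times k$ minors of the matrix of the first partial derivatives (with respect to the $m$ coordinates) of the elements of $J$; put $\Delta^iJ=\Delta_{m-i+1}J$ for $0\le i\le m$. One says that $\Delta^iJ$ is critical if $\Delta_{m-i+1}J\ne\mathcal A$ and $\Delta_{m-i}J=\mathcal A$; every proper ideal $J$ has exactly one critical extension. For a proper ideal $J$, the Thom–Boardman symbol $TB(J)=(i_1,i_2,\dots)$ is defined by the condition that $\Delta^{i_{1}}J$ is critical for $J$, $\Delta^{i_2}(\Delta^{i_1}J)$ is critical for $\Delta^{i_1}J$, and so on. Let $f=x^n+a_{n-1}x^{n-1}+\cdots+a_0$, $g=x^r+b_{r-1}x^{r-1}+\cdots+b_0$ and $fg=x^{n+r}+c_{n+r-1}x^{n+r-1}+\cdots+c_0$,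 and let $I(\mu_{n,r})\subseteq\mathcal A$ be the ideal generated by $c_0,\dots,c_{n+r-1}$. Define $d_{n-1},\dots,d_0$ recursively by $$d_{n-j}=a_{n-j}-b_{r-j}-\sum_{i+k=j,\ i\ge1,\ 1\le k\le r}d_{n-i}\,b_{r-k}\qquad(1\le j\le n),$$ where the term $b_{r-j}$ is omitted if $j>r$. Put $\psi_i=d_i$ for $0\le i<r$, and $$\psi_{sr+i}=\frac{\partial^s d_{r-1}}{\partial b_0^{\,s-1}\,\partial b_{r-1-i}}\qquad(0\le i<r,\ 1\le s\le q_1-1).$$ Then for every $s=1,\dots,q_1$, $$\underbrace{\Delta^r\cdots\Delta^r}_{s}\,I(\mu_{n,r})=I(\mu_{n,r})+(\psi_0,\dots,\psi_{sr-1}),$$ and each of these $q_1$ successive extensions by $\Delta^r$ is critical. In particular, the first $q_1$ entries of the Thom–Boardman symbol of $I(\mu_{n,r})$ are all equal to $r$. -/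

import Mathlib

open scoped Topology

namespace ThomBoardman

/-! ### The algebra of germs at the origin and its partial derivatives -/

section Germs

variable {ι : Type*} [Fintype ι]

/-- The algebra `𝒜` of germs at the origin of holomorphic functions on `ℂ^ι`, as a subring of
the ring of all germs of functions at the origin. -/
def germRing (ι : Type*) [Fintype ι] : Subring (Filter.Germ (𝓝 (0 : ι → ℂ)) ℂ) where
  carrier := {φ | ∃ f : (ι → ℂ) → ℂ, AnalyticAt ℂ f 0 ∧ (f : Filter.Germ (𝓝 (0 : ι → ℂ)) ℂ) = φ}
  mul_mem' := by
    rintro _ _ ⟨f, hf, rfl⟩ ⟨g, hg, rfl⟩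
    exact ⟨f * g, hf.mul hg, rfl⟩
  one_mem' := ⟨1, analyticAt_const, rfl⟩
  add_mem' := by
    rintro _ _ ⟨f, hf, rfl⟩ ⟨g, hg, rfl⟩
    exact ⟨f + g, hf.add hg, rfl⟩
  zero_mem' := ⟨0, analyticAt_const, rfl⟩
  neg_mem' := by
    rintro _ ⟨f, hf, rfl⟩
    exact ⟨-f, hf.neg, rfl⟩

/-- The germ at the origin of a function that is holomorphic there. -/
noncomputable def germOf (f : (ι → ℂ) → ℂ) (hf : AnalyticAt ℂ f 0) : germRing ι :=
  ⟨(f : Filter.Germ (𝓝 (0 : ι → ℂ)) ℂ), f, hf, rfl⟩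

/-- The coordinate function `x_i` as a germ. -/
noncomputable def coord (i : ι) : germRing ι :=
  germOf (fun x => x i)
    (ContinuousLinearMap.analyticAt (ContinuousLinearMap.proj (R := ℂ) (φ := fun _ : ι => ℂ) i) 0)

variable [DecidableEq ι]

/-- The partial derivative `∂φ/∂x_i` of a germ: the germ of the partial derivative of any
representative. -/
noncomputable def pderiv (i : ι) (φ : germRing ι) : germRing ι :=
  ⟨Filter.Germ.map' (fun (f : (ι → ℂ) → ℂ) (x : ι → ℂ) => fderiv ℂ f x (Pi.single i 1))
      (fun _ _ h => h.fderiv.mono fun x hx => by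
        have hx' := DFunLike.congr_fun hx (Pi.single i 1)
        exact hx') φ.1, by
    obtain ⟨_, f, hf, rfl⟩ := φ
    have h := (ContinuousLinearMap.analyticAt
      (ContinuousLinearMap.apply ℂ ℂ (Pi.single i (1 : ℂ) : ι → ℂ)) (fderiv ℂ f 0)).comp hf.fderiv
    exact ⟨fun x => fderiv ℂ f x (Pi.single i 1), h, rfl⟩⟩

/-! ### Jacobian extensions, critical extensions and the Thom-Boardman symbol -/

/-- The Jacobian extension `Δ_k J`: the ideal spanned by `J` and all minors of order `k` of the
Jacobian matrix of `J`, whose rows are indexed by the elements of `J` and whose columns are indexed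
by the coordinates. (The minors with a repeated row or column are zero.) -/
noncomputable def jacobianExt (k : ℕ) (J : Ideal (germRing ι)) : Ideal (germRing ι) :=
  J ⊔ Ideal.span {φ | ∃ f : Fin k → germRing ι, (∀ u, f u ∈ J) ∧ ∃ c : Fin k → ι,
    φ = (Matrix.of fun u v => pderiv (c v) (f u)).det}

/-- Upper indices: `Δ^i J = Δ_{m-i+1} J`, where `m` is the number of coordinates (`i ≤ m`). -/
noncomputable def upperExt (i : ℕ) (J : Ideal (germRing ι)) : Ideal (germRing ι) :=
  jacobianExt (Fintype.card ι + 1 - i) J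

/-- `Δ^i J = Δ_{m-i+1} J` is critical: `Δ_{m-i+1} J ≠ 𝒜` and `Δ_{m-i} J = 𝒜`. -/
def IsCritical (i : ℕ) (J : Ideal (germRing ι)) : Prop :=
  i ≤ Fintype.card ι ∧ upperExt i J ≠ ⊤ ∧ jacobianExt (Fintype.card ι - i) J = ⊤

/-- The least order `k` such that `Δ_k J` is not the whole algebra. It exists for every proper
ideal `J`, since there are no nonzero minors of order `m + 1`. -/
noncomputable def criticalOrder (J : Ideal (germRing ι)) : ℕ :=
  sInf {k | jacobianExt k J ≠ ⊤}

/-- The critical extension of `J`. -/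
noncomputable def criticalExt (J : Ideal (germRing ι)) : Ideal (germRing ι) :=
  jacobianExt (criticalOrder J) J

/-- The entries of the Thom-Boardman symbol `TB(J) = (i_1, i_2, …)`, with `i_{s+1}` at position `s`:
the upper index `m - k + 1` of the critical extension `Δ_k` of the `s`-th ideal in the sequence of
critical extensions that starts with `J`. -/
noncomputable def thomBoardman (J : Ideal (germRing ι)) (s : ℕ) : ℕ :=
  Fintype.card ι + 1 - criticalOrder (criticalExt^[s] J)

end Germs

/-! ### The polynomial multiplication map -/

section Multiplication

variable (n r : ℕ)

/-- The polynomial `f = x^n + a_{n-1} x^{n-1} + ⋯ + a_0` at a point `(a, b)` of `ℂ^n × ℂ^r`, whose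
coordinates are indexed by `Fin n ⊕ Fin r`. -/
noncomputable def fPoly (p : Fin n ⊕ Fin r → ℂ) : Polynomial ℂ :=
  Polynomial.X ^ n + ∑ i : Fin n, Polynomial.C (p (Sum.inl i)) * Polynomial.X ^ (i : ℕ)

/-- The polynomial `g = x^r + b_{r-1} x^{r-1} + ⋯ + b_0` at a point `(a, b)`. -/
noncomputable def gPoly (p : Fin n ⊕ Fin r → ℂ) : Polynomial ℂ :=
  Polynomial.X ^ r + ∑ j : Fin r, Polynomial.C (p (Sum.inr j)) * Polynomial.X ^ (j : ℕ)

/-- The multiplication map `μ_{n,r} : ℂ^n × ℂ^r → ℂ^{n+r}`, with components the non-leading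
coefficients `c_0, …, c_{n+r-1}` of `h = f g`. -/
noncomputable def mulMap (p : Fin n ⊕ Fin r → ℂ) (j : Fin (n + r)) : ℂ :=
  (fPoly n r p * gPoly n r p).coeff j

theorem analyticAt_mulMap (j : Fin (n + r)) : AnalyticAt ℂ (fun p => mulMap n r p j) 0 := by
  have hc : ∀ i : Fin n ⊕ Fin r, AnalyticAt ℂ (fun p : Fin n ⊕ Fin r → ℂ => p i) 0 := fun i =>
    ContinuousLinearMap.analyticAt
      (ContinuousLinearMap.proj (R := ℂ) (φ := fun _ : Fin n ⊕ Fin r => ℂ) i) 0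
  have hf : ∀ k, AnalyticAt ℂ (fun p => (fPoly n r p).coeff k) 0 := by
    intro k
    simp only [fPoly, Polynomial.coeff_add, Polynomial.finsetSum_coeff, Polynomial.coeff_C_mul]
    exact analyticAt_const.add (Finset.analyticAt_fun_sum _ fun i _ => (hc _).mul analyticAt_const)
  have hg : ∀ k, AnalyticAt ℂ (fun p => (gPoly n r p).coeff k) 0 := by
    intro k
    simp only [gPoly, Polynomial.coeff_add, Polynomial.finsetSum_coeff, Polynomial.coeff_C_mul]
    exact analyticAt_const.add (Finset.analyticAt_fun_sum _ fun i _ => (hc _).mul analyticAt_const)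
  simp only [mulMap, Polynomial.coeff_mul]
  exact Finset.analyticAt_fun_sum _ fun x _ => (hf _).mul (hg _)

/-- The ideal `I(μ_{n,r})` generated by the germs of the components of `μ_{n,r}`. -/
noncomputable def mulIdeal : Ideal (germRing (Fin n ⊕ Fin r)) :=
  Ideal.span (Set.range fun j : Fin (n + r) =>
    germOf (fun p => mulMap n r p j) (analyticAt_mulMap n r j))

/-- The coordinate germ `a_i` (`0 ≤ i < n`). -/
noncomputable def aGerm (i : ℕ) : germRing (Fin n ⊕ Fin r) :=
  if h : i < n then coord (Sum.inl ⟨i, h⟩) else 0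

/-- The coordinate germ `b_j` (`0 ≤ j < r`). -/
noncomputable def bGerm (j : ℕ) : germRing (Fin n ⊕ Fin r) :=
  if h : j < r then coord (Sum.inr ⟨j, h⟩) else 0

/-- `dRev n r j` is `d_{n-j}` for `1 ≤ j ≤ n`, given by the recursion
`d_{n-j} = a_{n-j} - b_{r-j} - ∑_{i+k=j} d_{n-i} b_{r-k}`, with the sum over `i ≥ 1` and
`1 ≤ k ≤ r`, where the term `b_{r-j}` is absent for `j > r`. -/
noncomputable def dRev (j : ℕ) : germRing (Fin n ⊕ Fin r) :=
  aGerm n r (n - j) - (if j ≤ r then bGerm n r (r - j) else 0) -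
    ∑ i : Fin j, if 1 ≤ (i : ℕ) ∧ j - i ≤ r then dRev i * bGerm n r (r - (j - i)) else 0
termination_by j
decreasing_by exact i.2

/-- The polynomial `d_i` for `0 ≤ i < n`. -/
noncomputable def d (i : ℕ) : germRing (Fin n ⊕ Fin r) := dRev n r (n - i)

/-- The partial derivative `∂φ/∂b_j` for `0 ≤ j < r`. -/
noncomputable def pderivB (j : ℕ) (φ : germRing (Fin n ⊕ Fin r)) : germRing (Fin n ⊕ Fin r) :=
  if h : j < r then pderiv (Sum.inr ⟨j, h⟩) φ else 0

/-- The sequence `ψ`: `ψ_i = d_i` for `i < r`, and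
`ψ_{sr+i} = ∂^s d_{r-1} / ∂b_0^{s-1} ∂b_{r-1-i}` for `i < r` and `s ≥ 1`. -/
noncomputable def psi (l : ℕ) : germRing (Fin n ⊕ Fin r) :=
  if l < r then d n r l
  else (pderivB n r 0)^[l / r - 1] (pderivB n r (r - 1 - l % r) (d n r (r - 1)))

end Multiplication

end ThomBoardman

/-!
The ideals in question are governed by divisibility. Let `J_s` be the ideal of the conditions
`f g = x ^ (n + r)` and `g ^ s ∣ f`, the second one being the vanishing of the coefficients of the
remainder of `f` modulo `g ^ s`; thus `J_0 = I(μ_{n,r})`, and `J_s ≠ 𝒜` as long as `s r ≤ n`, since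
at the origin `f = x ^ n` and `g = x ^ r`. The point is that `Δ_{n+1} J_s = J_{s+1}`.

Modulo `J_{s+1}` we have `g ∣ f`, and the derivatives of `f g` and of the remainder of `f` modulo
`g ^ s` along any coordinate are determined linearly by the `n` coefficients of one polynomial of
degree `< n`, namely `∂f + (f / g) ∂g`. Hence all minors of order `n + 1` vanish.

Conversely, the derivatives of the coefficients `c_r, …, c_{n+r-1}` along `a_0, …, a_{n-1}` form a
unitriangular matrix, so that `Δ_n J_s = 𝒜`, and bordering this minor shows that
`Δ_{n+1} J_s` contains `Y J_s` for the vector field `Y` with `Y g = 1` and `Y f = -q`, where `q` is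
the quotient of `f` by `g`. Now `Y (f g) = f - q g` is the remainder of `f` modulo `g`. If it
vanishes and `f = g ^ s Q + R`, with both `R` and `Y R` zero, then applying `Y` to
`f g = g ^ (s + 1) Q + R g` gives `0 = (s + 1) g ^ s Q + g ^ (s + 1) Y Q`, whence `g ∣ Q`.

Finally, `d_i` is the residue at infinity of `x ^ (r - 1 - i) f / g`, and differentiating
`f / g` with respect to the `b_j` shows that `ψ_{tr+i}` is `± t!` times the residue of
`x ^ (r - 1 - i) f / g ^ (t + 1)`. The vanishing of these residues for `t < s` and `i < r` means
that `g ^ s ∣ f`.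
-/

namespace ThomBoardman

open Polynomial

/-! ### Minors of derivatives -/

section Minors

variable {A B ι : Type*} [CommRing A] [CommRing B]

theorem det_eq_zero_of_row_mem_span {n : ℕ} {e : Fin n → Fin (n + 1) → B}
    {M : Matrix (Fin (n + 1)) (Fin (n + 1)) B}
    (h : ∀ u, M u ∈ Submodule.span B (Set.range e)) : M.det = 0 := by
  choose a ha using fun u => (Submodule.mem_span_range_iff_exists_fun B).1 (h u)
  have hM : M = Matrix.of (fun u => Fin.cons 0 (a u)) * Matrix.of (Fin.cons 0 e) := by
    ext u v
    simp [← ha u, Matrix.mul_apply, Fin.sum_univ_succ]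
  rw [hM, Matrix.det_mul, Matrix.det_eq_zero_of_column_eq_zero 0 fun u => by simp, zero_mul]

/-- The Jacobian extension `Δ_k J` with respect to a family of derivations in place of the partial
derivatives: the ideal spanned by `J` and the minors of order `k` of the matrix of derivatives of
the elements of `J`. -/
def jacExt (D : ι → Derivation ℤ A A) (k : ℕ) (J : Ideal A) : Ideal A :=
  J ⊔ Ideal.span {φ | ∃ f : Fin k → A, (∀ u, f u ∈ J) ∧ ∃ c : Fin k → ι,
    φ = (Matrix.of fun u v => D (c v) (f u)).det}

variable (D : ι → Derivation ℤ A A)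

theorem le_jacExt (k : ℕ) (J : Ideal A) : J ≤ jacExt D k J := le_sup_left

theorem det_mem_jacExt {κ : Type*} [Fintype κ] [DecidableEq κ] {J : Ideal A} {f : κ → A}
    (hf : ∀ u, f u ∈ J) (c : κ → ι) :
    (Matrix.of fun u v => D (c v) (f u)).det ∈ jacExt D (Fintype.card κ) J := by
  rw [← Matrix.det_submatrix_equiv_self (Fintype.equivFin κ).symm]
  exact Ideal.mem_sup_right (Ideal.subset_span ⟨_, fun u => hf _, _, rfl⟩)

theorem jacExt_antitone (J : Ideal A) : Antitone fun k => jacExt D k J := by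
  refine antitone_nat_of_succ_le fun k => sup_le le_sup_left (Ideal.span_le.2 ?_)
  rintro _ ⟨f, hf, c, rfl⟩
  rw [SetLike.mem_coe, Matrix.det_succ_row_zero]
  refine Ideal.sum_mem _ fun j _ => Ideal.mul_mem_left _ _ ?_
  have hminor := det_mem_jacExt D (fun u => hf (Fin.succ u)) (fun v => c (j.succAbove v))
  rwa [Fintype.card_fin] at hminor

theorem jacExt_span_le_ker {n : ℕ} {S : Set A} {φ : A →+* B} (e : Fin n → ι → B)
    (hφ : Ideal.span S ≤ RingHom.ker φ)
    (hS : ∀ f ∈ S, (fun v => φ (D v f)) ∈ Submodule.span B (Set.range e)) :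
    jacExt D (n + 1) (Ideal.span S) ≤ RingHom.ker φ := by
  have hJ : ∀ f ∈ Ideal.span S, (fun v => φ (D v f)) ∈ Submodule.span B (Set.range e) := by
    intro f hf
    induction hf using Submodule.span_induction with
    | mem f hf => exact hS f hf
    | zero =>
      simp only [map_zero]
      exact Submodule.zero_mem _
    | add f g _ _ hf hg =>
      simp only [map_add]
      exact Submodule.add_mem _ hf hg
    | smul a f hfS hf =>
      have hf0 : φ f = 0 := hφ hfS
      simpa [hf0, Pi.smul_def] using Submodule.smul_mem _ (φ a) hf
  refine sup_le hφ (Ideal.span_le.2 ?_)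
  rintro _ ⟨f, hf, c, rfl⟩
  rw [SetLike.mem_coe, RingHom.mem_ker, RingHom.map_det]
  refine det_eq_zero_of_row_mem_span (e := fun k v => e k (c v)) fun u => ?_
  obtain ⟨a, ha⟩ := (Submodule.mem_span_range_iff_exists_fun B).1 (hJ (f u) (hf u))
  refine (Submodule.mem_span_range_iff_exists_fun B).2 ⟨a, funext fun v => ?_⟩
  simpa using congrFun ha (c v)

/-- In the minor of `h` and `f` along `α` and `β`, the last column can be replaced by the values of
`Y`, which vanish modulo `J` except for `Y f`. -/
theorem derivative_mem_jacExt {n : ℕ} {J : Ideal A} {h : Fin n → A} (hJ : ∀ k, h k ∈ J)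
    (α : Fin n → ι) (hdet : (Matrix.of fun k l => D (α l) (h k)).det = 1) (β : ι) (q : Fin n → A)
    {Y : Derivation ℤ A A} (hY : ∀ f, Y f = D β f - ∑ l, q l * D (α l) f)
    (hYh : ∀ k, Y (h k) ∈ J) {f : A} (hf : f ∈ J) : Y f ∈ jacExt D (n + 1) J := by
  let M : Matrix (Fin n ⊕ Unit) (Fin n ⊕ Unit) A :=
    Matrix.of fun u v => D (Sum.elim α (fun _ => β) v) (Sum.elim h (fun _ => f) u)
  have hM : M.det ∈ jacExt D (n + 1) J := by
    have hu : ∀ u : Fin n ⊕ Unit, Sum.elim h (fun _ => f) u ∈ J := by rintro (k | _) <;> simp [*]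
    simpa using det_mem_jacExt D hu (Sum.elim α fun _ => β)
  have hcol : M.updateCol (Sum.inr ()) (fun u => ∑ v, Sum.elim (-q) 1 v • M u v) =
      Matrix.fromBlocks (Matrix.of fun k l => D (α l) (h k)) (Matrix.of fun k _ => Y (h k))
        (Matrix.of fun _ l => D (α l) f) (Matrix.of fun _ _ => Y f) := by
    ext (u | u) (v | v) <;>
      simp [M, hY, neg_add_eq_sub]
  have hMY : Y f - M.det ∈ J := by
    rw [← Ideal.Quotient.eq]
    have hdetM := Matrix.det_updateCol_sum M (Sum.inr ()) (Sum.elim (-q) 1)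
    rw [hcol] at hdetM
    have h0 : (Matrix.of fun (k : Fin n) (_ : Unit) => Y (h k)).map (Ideal.Quotient.mk J) = 0 := by
      ext k _
      exact Ideal.Quotient.eq_zero_iff_mem.2 (hYh k)
    have := congrArg (Ideal.Quotient.mk J) hdetM
    rw [RingHom.map_det, RingHom.mapMatrix_apply, Matrix.fromBlocks_map, h0,
      Matrix.det_fromBlocks_zero₁₂, ← RingHom.mapMatrix_apply, ← RingHom.map_det, hdet] at this
    simpa using this
  exact (Submodule.sub_mem_iff_left _ hM).1 (le_jacExt D (n + 1) J hMY)

end Minors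

/-! ### Coefficientwise derivations and division with remainder -/

section Derivations

variable {A B : Type*} [CommRing A] [CommRing B]

/-- The derivation of `A[X]` that acts on the coefficients and kills `X`. -/
noncomputable def coeffDer (D : Derivation ℤ A A) : Derivation ℤ A[X] A[X] :=
  PolynomialModule.equivPolynomialSelf.compDer D.mapCoeffs

theorem coeff_coeffDer (D : Derivation ℤ A A) (p : A[X]) (i : ℕ) :
    (coeffDer D p).coeff i = D (p.coeff i) := rfl

theorem coeffDer_C (D : Derivation ℤ A A) (a : A) : coeffDer D (C a) = C (D a) := by
  ext i
  rw [coeff_coeffDer, coeff_C, coeff_C]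
  split_ifs
  · rfl
  · exact map_zero D

theorem coeffDer_X_pow (D : Derivation ℤ A A) (k : ℕ) : coeffDer D (X ^ k) = 0 := by
  ext i
  rw [coeff_coeffDer, coeff_X_pow, coeff_zero]
  split_ifs
  · exact D.map_one_eq_zero
  · exact map_zero D

theorem degree_coeffDer_le (D : Derivation ℤ A A) (p : A[X]) :
    (coeffDer D p).degree ≤ p.degree := by
  refine (degree_le_iff_coeff_zero _ _).2 fun m hm => ?_
  rw [coeff_coeffDer, coeff_eq_zero_of_degree_lt hm, map_zero]

theorem natDegree_coeffDer_le (D : Derivation ℤ A A) (p : A[X]) :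
    (coeffDer D p).natDegree ≤ p.natDegree :=
  natDegree_le_natDegree (degree_coeffDer_le D p)

theorem degree_coeffDer_lt [Nontrivial A] (D : Derivation ℤ A A) {p : A[X]} (hp : p.Monic) :
    (coeffDer D p).degree < p.degree := by
  refine (degree_coeffDer_le D p).lt_of_ne fun h => ?_
  have hlead : (coeffDer D p).coeff p.natDegree = 0 := by
    rw [coeff_coeffDer, hp.coeff_natDegree, D.map_one_eq_zero]
  rw [← natDegree_eq_of_degree_eq h, coeff_natDegree, leadingCoeff_eq_zero] at hlead
  exact hp.ne_zero (degree_eq_bot.1 (h ▸ hlead ▸ degree_zero))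

variable (D : Derivation ℤ A A) {F G : A[X]}

/-- `G` times this polynomial is the derivative of `F * G` along `D`, up to multiples of
`F %ₘ G`. -/
noncomputable def derivQuotient (D : Derivation ℤ A A) (F G : A[X]) : A[X] :=
  coeffDer D F + (F /ₘ G) * coeffDer D G

theorem coeffDer_mul_eq (D : Derivation ℤ A A) (F G : A[X]) :
    coeffDer D (F * G) = G * derivQuotient D F G + (F %ₘ G) * coeffDer D G := by
  rw [derivQuotient, Derivation.leibniz, smul_eq_mul, smul_eq_mul]
  linear_combination -coeffDer D G * modByMonic_add_div F G

theorem map_coeffDer_mul (hG : G.Monic) {φ : A →+* B} (h : G.map φ ∣ F.map φ) :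
    (coeffDer D (F * G)).map φ = G.map φ * (derivQuotient D F G).map φ := by
  have hF : (F %ₘ G).map φ = 0 := by
    rwa [map_modByMonic φ hG, modByMonic_eq_zero_iff_dvd (hG.map φ)]
  rw [coeffDer_mul_eq, Polynomial.map_add, Polynomial.map_mul, Polynomial.map_mul, hF, zero_mul,
    add_zero]

theorem degree_derivQuotient_lt [Nontrivial A] (hF : F.Monic) (hG : G.Monic) :
    (derivQuotient D F G).degree < F.degree := by
  refine (degree_add_le _ _).trans_lt (max_lt (degree_coeffDer_lt D hF) ?_)
  by_cases hq : F /ₘ G = 0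
  · simpa [hq, bot_lt_iff_ne_bot] using hF.ne_zero
  · have hGF : G.degree ≤ F.degree := not_lt.1 (mt (divByMonic_eq_zero_iff hG).2 hq)
    calc ((F /ₘ G) * coeffDer D G).degree
        ≤ (F /ₘ G).degree + (coeffDer D G).degree := degree_mul_le _ _
      _ < (F /ₘ G).degree + G.degree :=
        WithBot.add_lt_add_left (mt degree_eq_bot.1 hq) (degree_coeffDer_lt D hG)
      _ = F.degree := by rw [add_comm, degree_add_divByMonic hG hGF]

theorem map_coeffDer_modByMonic_pow (hG : G.Monic) {φ : A →+* B} {s : ℕ}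
    (h : G.map φ ^ (s + 1) ∣ F.map φ) :
    (coeffDer D (F %ₘ G ^ s)).map φ = (derivQuotient D F G).map φ %ₘ G.map φ ^ s := by
  nontriviality B
  have := φ.domain_nontrivial
  obtain ⟨Q, hQ⟩ := h
  have hquo : (F /ₘ G ^ s).map φ = G.map φ * Q := by
    rw [map_divByMonic φ (hG.pow s), Polynomial.map_pow, hQ, pow_succ, mul_assoc,
      mul_divByMonic_cancel_left _ ((hG.map φ).pow s)]
  have hF : (F /ₘ G).map φ = G.map φ ^ s * Q := by
    rw [map_divByMonic φ hG, hQ, pow_succ', mul_assoc, mul_divByMonic_cancel_left _ (hG.map φ)]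
  have hpow : (coeffDer D (G ^ s)).map φ * G.map φ =
      G.map φ ^ s * (s * (coeffDer D G).map φ) := by
    rw [Derivation.leibniz_pow]
    rcases s with _ | s
    · simp
    · simp only [add_tsub_cancel_right, smul_eq_mul, nsmul_eq_mul, Polynomial.map_mul,
        Polynomial.map_pow, Polynomial.map_natCast]
      ring
  have hDF := congrArg (fun p => (coeffDer D p).map φ) (modByMonic_add_div F (G ^ s))
  simp only [map_add, Derivation.leibniz, smul_eq_mul, Polynomial.map_add, Polynomial.map_mul,
    Polynomial.map_pow, hquo] at hDF
  set P := (coeffDer D (F /ₘ G ^ s)).map φ + (s + 1) * Q * (coeffDer D G).map φ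
  refine (div_modByMonic_unique P _ ((hG.map φ).pow s) ⟨?_, ?_⟩).2.symm
  · rw [derivQuotient, Polynomial.map_add, Polynomial.map_mul, hF]
    linear_combination hDF - Q * hpow
  · calc ((coeffDer D (F %ₘ G ^ s)).map φ).degree
        ≤ (F %ₘ G ^ s).degree := degree_map_le.trans (degree_coeffDer_le D _)
      _ < (G ^ s).degree := degree_modByMonic_lt _ (hG.pow s)
      _ = (G.map φ ^ s).degree := by rw [← Polynomial.map_pow, (hG.pow s).degree_map]

theorem coeffDer_mul_eq_modByMonic {Y : Derivation ℤ A A} (hYG : coeffDer Y G = 1)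
    (hYF : coeffDer Y F = -(F /ₘ G)) : coeffDer Y (F * G) = F %ₘ G := by
  rw [coeffDer_mul_eq, derivQuotient, hYF, hYG, mul_one, mul_one, neg_add_cancel, mul_zero,
    zero_add]

theorem pow_succ_dvd_of_coeffDer_modByMonic_pow {Y : Derivation ℤ A A} (hG : G.Monic)
    (hYG : coeffDer Y G = 1) (hYF : coeffDer Y F = -(F /ₘ G)) {φ : A →+* B} {s : ℕ}
    (hs : IsUnit ((s + 1 : ℕ) : B)) (hF : (F %ₘ G).map φ = 0) (hR : (F %ₘ G ^ s).map φ = 0)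
    (hYR : (coeffDer Y (F %ₘ G ^ s)).map φ = 0) : G.map φ ^ (s + 1) ∣ F.map φ := by
  set Q := F /ₘ G ^ s with hQ
  have hFQ : F.map φ = G.map φ ^ s * Q.map φ := by
    rw [← modByMonic_add_div F (G ^ s), ← hQ, Polynomial.map_add, hR, zero_add,
      Polynomial.map_mul, Polynomial.map_pow]
  have hFG : F * G = (F %ₘ G ^ s) * G + G ^ (s + 1) * Q := by
    linear_combination -G * modByMonic_add_div F (G ^ s)
  have hY := congrArg (Polynomial.map φ) (coeffDer_mul_eq_modByMonic hYG hYF)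
  rw [hFG, hF] at hY
  simp only [map_add, Derivation.leibniz, Derivation.leibniz_pow, hYG, add_tsub_cancel_right,
    smul_eq_mul, nsmul_eq_mul, mul_one, Polynomial.map_add, Polynomial.map_mul,
    Polynomial.map_pow, Polynomial.map_natCast, hR, hYR, mul_zero, add_zero, zero_add] at hY
  have hcancel : ((s + 1 : ℕ) : B[X]) * Q.map φ + G.map φ * (coeffDer Y Q).map φ = 0 := by
    refine ((hG.map φ).pow s).mul_right_eq_zero_iff.1 ?_
    linear_combination hY
  obtain ⟨u, hu⟩ := hs.map (C : B →+* B[X])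
  have hdvd : G.map φ ∣ Q.map φ := by
    refine (u.isUnit.dvd_mul_left).1 ⟨-(coeffDer Y Q).map φ, ?_⟩
    rw [hu, map_natCast]
    linear_combination hcancel
  rw [hFQ, pow_succ]
  exact mul_dvd_mul_left _ hdvd

end Derivations

/-! ### The ideal of the divisibility `G ^ s ∣ F` -/

section DivIdeal

variable {A B ι : Type*} [CommRing A] [CommRing B]

/-- The ideal of the conditions `F * G = X ^ m` and `G ^ s ∣ F`, for monic `G`: it is spanned by the
coefficients of `F * G - X ^ m` and of the remainder of `F` modulo `G ^ s`. -/
noncomputable def divIdeal (m : ℕ) (F G : A[X]) (s : ℕ) : Ideal A :=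
  (F * G - X ^ m).contentIdeal ⊔ (F %ₘ G ^ s).contentIdeal

theorem contentIdeal_le_ker_iff {p : A[X]} {φ : A →+* B} :
    p.contentIdeal ≤ RingHom.ker φ ↔ p.map φ = 0 := by
  rw [← Ideal.map_eq_bot_iff_le_ker, ← contentIdeal_map_eq_map_contentIdeal,
    contentIdeal_eq_bot_iff]

variable {m n s : ℕ} {F G : A[X]}

theorem divIdeal_le_ker_iff (hG : G.Monic) {φ : A →+* B} :
    divIdeal m F G s ≤ RingHom.ker φ ↔
      F.map φ * G.map φ = X ^ m ∧ G.map φ ^ s ∣ F.map φ := by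
  rw [divIdeal, sup_le_iff, contentIdeal_le_ker_iff, contentIdeal_le_ker_iff,
    map_modByMonic φ (hG.pow s), Polynomial.map_pow,
    modByMonic_eq_zero_iff_dvd ((hG.map φ).pow s), Polynomial.map_sub, sub_eq_zero,
    Polynomial.map_mul, Polynomial.map_pow, map_X]

theorem divIdeal_zero (m : ℕ) (F G : A[X]) :
    divIdeal m F G 0 = (F * G - X ^ m).contentIdeal := by
  rw [divIdeal, pow_zero, modByMonic_one, contentIdeal_zero, sup_bot_eq]

theorem contentIdeal_sub_X_pow {p : A[X]} (hp : p.Monic) (hm : p.natDegree = m) :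
    (p - X ^ m).contentIdeal = Ideal.span (Set.range fun j : Fin m => p.coeff j) := by
  have hcoeff : ∀ j < m, (p - X ^ m).coeff j = p.coeff j := fun j hj => by
    rw [coeff_sub, coeff_X_pow, if_neg hj.ne, sub_zero]
  refine le_antisymm (Ideal.span_le.2 fun a ha => ?_) (Ideal.span_le.2 ?_)
  · obtain ⟨j, hj, rfl⟩ := mem_coeffs_iff.1 ha
    have hjm : j < m := by
      by_contra! hmj
      refine mem_support_iff.1 hj ?_
      rcases hmj.eq_or_lt with rfl | hmj
      · rw [coeff_sub, coeff_X_pow_self, ← hm, hp.coeff_natDegree, sub_self]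
      · rw [coeff_sub, coeff_X_pow, if_neg hmj.ne', coeff_eq_zero_of_natDegree_lt (hm ▸ hmj),
          sub_zero]
    exact Ideal.subset_span ⟨⟨j, hjm⟩, (hcoeff j hjm).symm⟩
  · rintro _ ⟨j, rfl⟩
    have hmem := coeff_mem_contentIdeal (p - X ^ m) j
    rwa [hcoeff j j.2] at hmem

theorem divIdeal_mono (m : ℕ) (F : A[X]) (hG : G.Monic) : Monotone (divIdeal m F G) := by
  intro s t hst
  have h := (divIdeal_le_ker_iff hG).1 (Ideal.mk_ker (I := divIdeal m F G t)).ge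
  rw [← Ideal.mk_ker (I := divIdeal m F G t)]
  exact (divIdeal_le_ker_iff hG).2 ⟨h.1, (pow_dvd_pow _ hst).trans h.2⟩

theorem divIdeal_ne_top [Nontrivial B] (hG : G.Monic) {φ : A →+* B} {r : ℕ}
    (hF : F.map φ = X ^ n) (hGφ : G.map φ = X ^ r) (hs : s * r ≤ n) :
    divIdeal (n + r) F G s ≠ ⊤ := by
  have hle : divIdeal (n + r) F G s ≤ RingHom.ker φ := by
    refine (divIdeal_le_ker_iff hG).2 ⟨by rw [hF, hGφ, pow_add], ?_⟩
    rw [hF, hGφ, ← pow_mul, mul_comm]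
    exact pow_dvd_pow X hs
  exact fun htop => RingHom.ker_ne_top φ (top_le_iff.1 (htop ▸ hle))

theorem coeff_mul_sub_X_pow_mem_divIdeal (m : ℕ) (F G : A[X]) (s i : ℕ) :
    (F * G - X ^ m).coeff i ∈ divIdeal m F G s :=
  Ideal.mem_sup_left (coeff_mem_contentIdeal _ i)

theorem coeff_modByMonic_mem_divIdeal (m : ℕ) (F G : A[X]) (s i : ℕ) :
    (F %ₘ G ^ s).coeff i ∈ divIdeal m F G s :=
  Ideal.mem_sup_right (coeff_mem_contentIdeal _ i)

theorem linearMap_mem_span_coeff (T : B[X] →ₗ[B] B) {p : ι → B[X]}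
    (hp : ∀ v, (p v).degree < n) :
    (fun v => T (p v)) ∈ Submodule.span B (Set.range fun (k : Fin n) v => (p v).coeff k) := by
  refine (Submodule.mem_span_range_iff_exists_fun B).2 ⟨fun k => T (X ^ (k : ℕ)), ?_⟩
  funext v
  conv_rhs => rw [← sum_C_mul_X_pow_eq (p v), ← sum_fin _ (by simp) (hp v), map_sum]
  simp only [Finset.sum_apply, Pi.smul_apply, smul_eq_mul, ← smul_eq_C_mul, map_smul]
  exact Finset.sum_congr rfl fun k _ => mul_comm _ _

variable (D : ι → Derivation ℤ A A)

/-- Modulo the right hand side, all derivatives of generators of the ideal on the left along `D v`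
are fixed linear combinations of the `n` coefficients of `derivQuotient (D v) F G`. -/
theorem jacExt_divIdeal_le (hF : F.Monic) (hG : G.Monic) (hn : F.natDegree = n) :
    jacExt D (n + 1) (divIdeal m F G s) ≤ divIdeal m F G (s + 1) := by
  nontriviality A
  set φ := Ideal.Quotient.mk (divIdeal m F G (s + 1))
  have hker : RingHom.ker φ = divIdeal m F G (s + 1) := Ideal.mk_ker
  have hφ := ((divIdeal_le_ker_iff hG).1 hker.ge).2
  have hdeg : ∀ v, ((derivQuotient (D v) F G).map φ).degree < n := fun v =>
    degree_map_le.trans_lt <| hn ▸ degree_eq_natDegree hF.ne_zero ▸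
      degree_derivQuotient_lt (D v) hF hG
  have hspan : divIdeal m F G s = Ideal.span (((F * G - X ^ m).coeffs : Set A) ∪
      ((F %ₘ G ^ s).coeffs : Set A)) := by
    rw [Ideal.span_union]
    rfl
  have hle : divIdeal m F G s ≤ RingHom.ker φ := hker.symm ▸ divIdeal_mono m F hG s.le_succ
  rw [hspan] at hle ⊢
  rw [← hker]
  refine jacExt_span_le_ker D (fun k v => ((derivQuotient (D v) F G).map φ).coeff k) hle ?_
  rintro f (hf | hf) <;> obtain ⟨i, -, rfl⟩ := mem_coeffs_iff.1 hf
  · convert linearMap_mem_span_coeff (lcoeff _ i ∘ₗ LinearMap.mulLeft _ (G.map φ)) hdeg with v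
    have hGF := (dvd_pow_self _ s.succ_ne_zero).trans hφ
    rw [← coeff_coeffDer, ← coeff_map, map_sub, coeffDer_X_pow, sub_zero,
      map_coeffDer_mul _ hG hGF]
    rfl
  · convert linearMap_mem_span_coeff (lcoeff _ i ∘ₗ modByMonicHom (G.map φ ^ s)) hdeg with v
    rw [← coeff_coeffDer, ← coeff_map, map_coeffDer_modByMonic_pow _ hG hφ]
    rfl

section Lower

variable {α : Fin n → ι} {β : ι}
  (hαF : ∀ l, coeffDer (D (α l)) F = X ^ (l : ℕ)) (hαG : ∀ l, coeffDer (D (α l)) G = 0)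
  (hβF : coeffDer (D β) F = 0) (hβG : coeffDer (D β) G = 1)
include hαF hαG

theorem det_coeff_mul_eq_one (hG : G.Monic) (m : ℕ) :
    (Matrix.of fun k l : Fin n => D (α l) ((F * G - X ^ m).coeff (k + G.natDegree))).det = 1 := by
  have hentry : ∀ k l : Fin n, D (α l) ((F * G - X ^ m).coeff (k + G.natDegree)) =
      (G * X ^ (l : ℕ)).coeff (k + G.natDegree) := by
    intro k l
    rw [← coeff_coeffDer, map_sub, coeffDer_X_pow, Derivation.leibniz, hαF, hαG, smul_zero,
      zero_add, sub_zero, smul_eq_mul]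
  simp only [hentry, coeff_mul_X_pow']
  rw [Matrix.det_of_isUpperTriangular]
  · simp [hG.coeff_natDegree]
  · intro k l hkl
    have hkl : l < k := hkl
    rw [Matrix.of_apply, if_pos (by omega), coeff_eq_zero_of_natDegree_lt (by omega)]

theorem jacExt_divIdeal_eq_top (hG : G.Monic) :
    jacExt D n (divIdeal m F G s) = ⊤ := by
  have hdet := det_mem_jacExt D (fun k : Fin n =>
    coeff_mul_sub_X_pow_mem_divIdeal m F G s (k + G.natDegree)) α
  rw [det_coeff_mul_eq_one D hαF hαG hG, Fintype.card_fin] at hdet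
  exact (Ideal.eq_top_iff_one _).2 hdet

include hβF hβG

theorem exists_vectorField [Nontrivial A] (hG : G.Monic) (hF : F ≠ 0) (hn : F.natDegree = n) :
    ∃ Y : Derivation ℤ A A, (∀ f, Y f = D β f - ∑ l : Fin n, (F /ₘ G).coeff l * D (α l) f) ∧
      coeffDer Y G = 1 ∧ coeffDer Y F = -(F /ₘ G) := by
  have hGpos : 0 < G.degree := by simpa [hβG] using degree_coeffDer_lt (D β) hG
  have hY : ∀ f, (D β - ∑ l : Fin n, (F /ₘ G).coeff l • D (α l)) f =
      D β f - ∑ l : Fin n, (F /ₘ G).coeff l * D (α l) f := by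
    intro f
    rw [Derivation.sub_apply, ← Derivation.coeFnAddMonoidHom_apply (∑ l : Fin n, _), map_sum]
    simp
  refine ⟨_, hY, ?_, ?_⟩
  · ext i
    simp only [coeff_coeffDer, hY]
    simp only [← coeff_coeffDer, hβG, hαG, coeff_zero, mul_zero, Finset.sum_const_zero, sub_zero]
  · have hdeg : (F /ₘ G).degree < n := by
      rw [← hn, ← degree_eq_natDegree hF]
      exact degree_divByMonic_lt F G hF hGpos
    conv_rhs => rw [← sum_C_mul_X_pow_eq (F /ₘ G), ← sum_fin _ (by simp) hdeg]
    ext i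
    simp only [coeff_coeffDer, hY]
    simp only [← coeff_coeffDer, hβF, hαF, coeff_zero, zero_sub, coeff_neg, finsetSum_coeff,
      coeff_C_mul]

theorem divIdeal_succ_le_jacExt (hF : F.Monic) (hG : G.Monic) (hn : F.natDegree = n)
    (hs : IsUnit ((s + 1 : ℕ) : A)) :
    divIdeal m F G (s + 1) ≤ jacExt D (n + 1) (divIdeal m F G s) := by
  nontriviality A
  obtain ⟨Y, hY, hYG, hYF⟩ := exists_vectorField D hαF hαG hβF hβG hG hF.ne_zero hn
  have hYcoeff : ∀ i, Y ((F * G - X ^ m).coeff i) = (F %ₘ G).coeff i := by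
    intro i
    rw [← coeff_coeffDer, map_sub, coeffDer_X_pow, sub_zero, coeffDer_mul_eq_modByMonic hYG hYF]
  set K := jacExt D (n + 1) (divIdeal m F G s)
  have hYK : ∀ f ∈ divIdeal m F G s, Y f ∈ K := by
    refine fun f hf => derivative_mem_jacExt D
      (fun k => coeff_mul_sub_X_pow_mem_divIdeal m F G s (k + G.natDegree)) α
      (det_coeff_mul_eq_one D hαF hαG hG m) β _ hY (fun k => ?_) hf
    rw [hYcoeff, coeff_eq_zero_of_degree_lt]
    · exact Submodule.zero_mem _
    · refine (degree_modByMonic_lt F hG).trans_le (degree_le_natDegree.trans ?_)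
      exact_mod_cast Nat.le_add_left _ _
  have hmap : ∀ p : A[X], (∀ i, p.coeff i ∈ K) → p.map (Ideal.Quotient.mk K) = 0 := by
    intro p hp
    ext i
    simpa using Ideal.Quotient.eq_zero_iff_mem.2 (hp i)
  have hle : divIdeal m F G s ≤ K := le_jacExt D _ _
  rw [← Ideal.mk_ker (I := K), divIdeal_le_ker_iff hG]
  refine ⟨((divIdeal_le_ker_iff hG).1 (hle.trans Ideal.mk_ker.ge)).1,
    pow_succ_dvd_of_coeffDer_modByMonic_pow hG hYG hYF
      (by simpa using hs.map (Ideal.Quotient.mk K)) (hmap _ fun i => ?_)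
      (hmap _ fun i => hle (coeff_modByMonic_mem_divIdeal m F G s i))
      (hmap _ fun i => hYK _ (coeff_modByMonic_mem_divIdeal m F G s i))⟩
  rw [← hYcoeff]
  exact hYK _ (coeff_mul_sub_X_pow_mem_divIdeal m F G s i)

theorem jacExt_divIdeal (hF : F.Monic) (hG : G.Monic) (hn : F.natDegree = n)
    (hs : IsUnit ((s + 1 : ℕ) : A)) :
    jacExt D (n + 1) (divIdeal m F G s) = divIdeal m F G (s + 1) :=
  (jacExt_divIdeal_le D hF hG hn).antisymm
    (divIdeal_succ_le_jacExt D hαF hαG hβF hβG hF hG hn hs)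

end Lower

end DivIdeal

/-! ### Residues at infinity -/

section Residues

variable {A B : Type*} [CommRing A] [CommRing B] {G : A[X]}

/-- The coefficient of `x⁻¹` in the expansion of `p / G ^ s` at infinity, for a monic polynomial
`G` of positive degree and `s ≥ 1`. -/
noncomputable def res (G : A[X]) (s : ℕ) : A[X] →ₗ[A] A :=
  lcoeff A (s * G.natDegree - 1) ∘ₗ modByMonicHom (G ^ s)

theorem res_apply (G : A[X]) (s : ℕ) (p : A[X]) :
    res G s p = (p %ₘ G ^ s).coeff (s * G.natDegree - 1) := rfl

theorem map_res (hG : G.Monic) (φ : A →+* B) (s : ℕ) (p : A[X]) :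
    φ (res G s p) = res (G.map φ) s (p.map φ) := by
  nontriviality B
  rw [res_apply, res_apply, hG.natDegree_map, ← coeff_map, map_modByMonic φ (hG.pow s),
    Polynomial.map_pow]

theorem res_pow_mul (hG : G.Monic) (s : ℕ) (p : A[X]) : res G s (G ^ s * p) = 0 := by
  rw [res_apply, self_mul_modByMonic (hG.pow s), coeff_zero]

theorem res_of_natDegree_lt (hG : G.Monic) {s : ℕ} {p : A[X]}
    (hp : p.natDegree < s * G.natDegree) : res G s p = p.coeff (s * G.natDegree - 1) := by
  nontriviality A
  rw [res_apply, (modByMonic_eq_self_iff (hG.pow s)).2]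
  exact degree_lt_degree (by rwa [hG.natDegree_pow])

theorem res_pow_succ_mul (hG : G.Monic) (hG0 : 0 < G.natDegree) (s : ℕ) (p : A[X]) :
    res G (s + 1) (G ^ s * p) = res G 1 p := by
  nontriviality A
  have hG1 : G ≠ 1 := fun h => hG0.ne' (h ▸ natDegree_one)
  have hv : (p %ₘ G).natDegree < G.natDegree := natDegree_modByMonic_lt p hG hG1
  have hpow : (G ^ s).natDegree = s * G.natDegree := hG.natDegree_pow s
  have hsplit : G ^ s * p = G ^ s * (p %ₘ G) + G ^ (s + 1) * (p /ₘ G) := by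
    linear_combination -G ^ s * modByMonic_add_div p G
  have hdeg : (G ^ s * (p %ₘ G)).natDegree < (s + 1) * G.natDegree :=
    natDegree_mul_le.trans_lt (by rw [hpow, add_one_mul]; omega)
  have hidx : (s + 1) * G.natDegree - 1 = s * G.natDegree + (G.natDegree - 1) := by
    rw [add_one_mul]
    omega
  rw [hsplit, map_add, res_pow_mul hG, add_zero, res_of_natDegree_lt hG hdeg, hidx,
    coeff_mul_add_eq_of_natDegree_le hpow.le (by omega), ← hpow, (hG.pow s).coeff_natDegree,
    one_mul, res_apply, pow_one, one_mul]

theorem natDegree_coeffDer_lt (D : Derivation ℤ A A) (hG : G.Monic) (hG0 : 0 < G.natDegree) :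
    (coeffDer D G).natDegree < G.natDegree := by
  have : Nontrivial A := nontrivial_iff.1 ⟨G, 0, ne_zero_of_natDegree_gt hG0⟩
  by_cases h : coeffDer D G = 0
  · rwa [h, natDegree_zero]
  · exact natDegree_lt_natDegree h (degree_coeffDer_lt D hG)

/-- Differentiation of `p / G ^ (s + 1)` with respect to a parameter. -/
theorem der_res (D : Derivation ℤ A A) (hG : G.Monic) (hG0 : 0 < G.natDegree) (s : ℕ)
    (p : A[X]) : D (res G (s + 1) p) = res G (s + 1) (coeffDer D p) -
      ((s + 1 : ℕ) : A) * res G (s + 2) (p * coeffDer D G) := by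
  nontriviality A
  set Q := p /ₘ G ^ (s + 1)
  set R := p %ₘ G ^ (s + 1)
  have hp : R + G ^ (s + 1) * Q = p := modByMonic_add_div p (G ^ (s + 1))
  have hRdeg : R.natDegree < (s + 1) * G.natDegree := by
    have hpow := hG.natDegree_pow (s + 1)
    rw [← hpow]
    refine natDegree_modByMonic_lt p (hG.pow _) fun h => ?_
    rw [h, natDegree_one] at hpow
    exact (Nat.mul_pos s.succ_pos hG0).ne hpow
  have hDR : D (res G (s + 1) p) = res G (s + 1) (coeffDer D R) := by
    rw [res_of_natDegree_lt hG ((natDegree_coeffDer_le D R).trans_lt hRdeg), coeff_coeffDer,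
      res_apply]
  have hDp : coeffDer D p = coeffDer D R + G ^ (s + 1) * coeffDer D Q +
      ((s + 1 : ℕ) : A) • (G ^ s * (Q * coeffDer D G)) := by
    rw [← hp, map_add, Derivation.leibniz, Derivation.leibniz_pow, smul_eq_C_mul]
    simp only [smul_eq_mul, nsmul_eq_mul, map_natCast, add_tsub_cancel_right]
    ring
  have hRG : res G (s + 2) (R * coeffDer D G) = 0 := by
    have hdeg : (R * coeffDer D G).natDegree < (s + 2) * G.natDegree - 1 := by
      have hDG := natDegree_coeffDer_lt D hG hG0
      have hidx : (s + 2) * G.natDegree = (s + 1) * G.natDegree + G.natDegree := by ring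
      exact natDegree_mul_le.trans_lt (by omega)
    rw [res_of_natDegree_lt hG (hdeg.trans_le (Nat.sub_le _ _)),
      coeff_eq_zero_of_natDegree_lt hdeg]
  have hpG : res G (s + 2) (p * coeffDer D G) = res G 1 (Q * coeffDer D G) := by
    rw [← hp, add_mul, mul_assoc, map_add, hRG, zero_add, res_pow_succ_mul hG hG0]
  rw [hDR, hDp, hpG, map_add, map_add, res_pow_mul hG, map_smul, res_pow_succ_mul hG hG0,
    smul_eq_mul]
  ring

theorem forall_res_one_eq_zero_iff_dvd (hG : G.Monic) (hG0 : 0 < G.natDegree) {F : A[X]} :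
    (∀ i < G.natDegree, res G 1 (F * X ^ i) = 0) ↔ G ∣ F := by
  refine ⟨fun h => ?_, ?_⟩
  · rw [← modByMonic_eq_zero_iff_dvd hG]
    by_contra hv
    set v := F %ₘ G
    have hvdeg : v.natDegree < G.natDegree :=
      natDegree_modByMonic_lt F hG fun h => hG0.ne' (h ▸ natDegree_one)
    set i := G.natDegree - 1 - v.natDegree
    have hsplit : F * X ^ i = v * X ^ i + G ^ 1 * (F /ₘ G * X ^ i) := by
      linear_combination -X ^ i * modByMonic_add_div F G
    have hlead : res G 1 (F * X ^ i) = v.leadingCoeff := by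
      have hdeg : (v * X ^ i).natDegree < 1 * G.natDegree :=
        (natDegree_mul_le_of_le le_rfl (natDegree_X_pow_le i)).trans_lt (by omega)
      rw [hsplit, map_add, res_pow_mul hG, add_zero, res_of_natDegree_lt hG hdeg, leadingCoeff,
        show 1 * G.natDegree - 1 = v.natDegree + i by omega, coeff_mul_X_pow]
    exact hv (leadingCoeff_eq_zero.1 (hlead.symm.trans (h i (by omega))))
  · rintro ⟨H, rfl⟩ i -
    simpa only [pow_one, mul_assoc] using res_pow_mul hG 1 (H * X ^ i)

theorem forall_res_eq_zero_iff_pow_dvd (hG : G.Monic) (hG0 : 0 < G.natDegree) {F : A[X]} {s : ℕ} :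
    (∀ t < s, ∀ i < G.natDegree, res G (t + 1) (F * X ^ i) = 0) ↔ G ^ s ∣ F := by
  induction s with
  | zero => simp
  | succ s ih =>
    rw [Nat.forall_lt_succ_right, ih]
    constructor
    · rintro ⟨⟨H, rfl⟩, h⟩
      simp only [mul_assoc, res_pow_succ_mul hG hG0] at h
      rw [pow_succ]
      exact mul_dvd_mul_left _ ((forall_res_one_eq_zero_iff_dvd hG hG0).1 h)
    · rintro ⟨H, rfl⟩
      refine ⟨⟨G * H, by ring⟩, fun i _ => ?_⟩
      rw [mul_assoc, res_pow_mul hG]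

theorem forall_map_res_eq_zero_iff_pow_dvd (hG : G.Monic) (hG0 : 0 < G.natDegree) (φ : A →+* B)
    {F : A[X]} {s : ℕ} :
    (∀ t < s, ∀ i < G.natDegree, φ (res G (t + 1) (F * X ^ i)) = 0) ↔
      G.map φ ^ s ∣ F.map φ := by
  cases subsingleton_or_nontrivial B
  · exact iff_of_true (fun _ _ _ _ => Subsingleton.elim _ _) ⟨0, Subsingleton.elim _ _⟩
  · have hdeg : (G.map φ).natDegree = G.natDegree := hG.natDegree_map φ
    rw [← forall_res_eq_zero_iff_pow_dvd (hG.map φ) (hdeg ▸ hG0), hdeg]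
    simp only [map_res hG, Polynomial.map_mul, Polynomial.map_pow, map_X]

theorem coeff_X_pow_mul_divByMonic (hG : G.Monic) (hG0 : 0 < G.natDegree) (i : ℕ) (p : A[X]) :
    ((X ^ (i + 1) * p) /ₘ G).coeff i = res G 1 p := by
  nontriviality A
  have hG1 : G ≠ 1 := fun h => hG0.ne' (h ▸ natDegree_one)
  set v := p %ₘ G
  set ρ := (X ^ (i + 1) * p) %ₘ G
  set w := (X ^ (i + 1) * p) /ₘ G - X ^ (i + 1) * (p /ₘ G) with hw
  have hvdeg : v.natDegree < G.natDegree := natDegree_modByMonic_lt _ hG hG1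
  have hρdeg : ρ.natDegree < G.natDegree := natDegree_modByMonic_lt _ hG hG1
  have hGw : G * w = v * X ^ (i + 1) - ρ := by
    linear_combination modByMonic_add_div (X ^ (i + 1) * p) G -
      X ^ (i + 1) * modByMonic_add_div p G
  have hwdeg : w.natDegree ≤ i := by
    by_contra! hlt
    have hGwdeg : (G * w).natDegree ≤ G.natDegree + i := by
      rw [hGw]
      have hvX : (v * X ^ (i + 1)).natDegree ≤ v.natDegree + (i + 1) :=
        natDegree_mul_le_of_le le_rfl (natDegree_X_pow_le _)
      exact (natDegree_sub_le _ _).trans (max_le (by omega) (by omega))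
    rw [hG.natDegree_mul' (ne_zero_of_natDegree_gt hlt)] at hGwdeg
    omega
  calc ((X ^ (i + 1) * p) /ₘ G).coeff i
      = w.coeff i := by simp [hw, coeff_X_pow_mul']
    _ = (G * w).coeff (G.natDegree + i) := by
      rw [coeff_mul_add_eq_of_natDegree_le le_rfl hwdeg, hG.coeff_natDegree, one_mul]
    _ = v.coeff (G.natDegree - 1) := by
      rw [hGw, coeff_sub, coeff_eq_zero_of_natDegree_lt (p := ρ) (by omega), sub_zero,
        show G.natDegree + i = G.natDegree - 1 + (i + 1) by omega, coeff_mul_X_pow]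
    _ = res G 1 p := by rw [res_apply, pow_one, one_mul]

theorem coeff_mul_sub {p q : A[X]} {n r j : ℕ} (hp : p.natDegree ≤ n) (hq : q.natDegree ≤ r)
    (hj : j ≤ n) : (p * q).coeff (n + r - j) =
      ∑ i ∈ Finset.range (j + 1),
        if j - i ≤ r then p.coeff (n - i) * q.coeff (r - (j - i)) else 0 := by
  rw [← revAt_le (by omega : j ≤ n + r), ← coeff_reflect, reflect_mul p q hp hq, coeff_mul,
    Finset.Nat.sum_antidiagonal_eq_sum_range_succ_mk]
  refine Finset.sum_congr rfl fun i hi => ?_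
  rw [Finset.mem_range] at hi
  rw [coeff_reflect, coeff_reflect, revAt_le (by omega)]
  split_ifs with h
  · rw [revAt_le h]
  · rw [revAt_eq_self_of_lt (by omega), coeff_eq_zero_of_natDegree_lt (p := q) (by omega), mul_zero]

theorem monic_divByMonic {p q : A[X]} (hp : p.Monic) (hq : q.Monic)
    (hpq : q.natDegree ≤ p.natDegree) : (p /ₘ q).Monic := by
  nontriviality A
  have hdeg : q.degree ≤ p.degree := by
    rwa [degree_eq_natDegree hp.ne_zero, degree_eq_natDegree hq.ne_zero, Nat.cast_le]
  exact (leadingCoeff_divByMonic_of_monic hq hdeg).trans hp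

theorem coeff_divByMonic_mul (hG : G.Monic) {i : ℕ} (hi : G.natDegree ≤ i) (p : A[X]) :
    (p /ₘ G * G).coeff i = p.coeff i := by
  nontriviality A
  have hmod : (p %ₘ G).coeff i = 0 := coeff_eq_zero_of_degree_lt <|
    (degree_modByMonic_lt p hG).trans_le <|
      (degree_eq_natDegree hG.ne_zero).trans_le (Nat.cast_le.2 hi)
  conv_rhs => rw [← modByMonic_add_div p G, coeff_add, hmod, zero_add, mul_comm]

theorem coeff_divByMonic_rec {F : A[X]} (hG : G.Monic) (hF : F.Monic) {n r j : ℕ}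
    (hGr : G.natDegree = r) (hFn : F.natDegree = n) (hj : 1 ≤ j) (hjn : j ≤ n) :
    ((X ^ r * F) /ₘ G).coeff (n - j) = F.coeff (n - j) - (if j ≤ r then G.coeff (r - j) else 0) -
      ∑ i ∈ Finset.range j, if 1 ≤ i ∧ j - i ≤ r then
        ((X ^ r * F) /ₘ G).coeff (n - i) * G.coeff (r - (j - i)) else 0 := by
  nontriviality A
  set Q := (X ^ r * F) /ₘ G with hQ
  have hXF : (X ^ r * F).natDegree = n + r := by
    rw [(monic_X_pow r).natDegree_mul hF, natDegree_X_pow, hFn, add_comm]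
  have hQn : Q.natDegree = n := by
    rw [hQ, natDegree_divByMonic _ hG, hXF, hGr, Nat.add_sub_cancel]
  have hQlead : Q.coeff n = 1 :=
    hQn ▸ monic_divByMonic ((monic_X_pow r).mul hF) hG (by omega)
  have hGlead : G.coeff r = 1 := hGr ▸ hG
  have hFcoeff : F.coeff (n - j) = (Q * G).coeff (n + r - j) := by
    rw [coeff_divByMonic_mul hG (by omega), show n + r - j = n - j + r by omega, coeff_X_pow_mul]
  rw [hFcoeff, coeff_mul_sub hQn.le hGr.le hjn, Finset.sum_range_succ]
  obtain ⟨j, rfl⟩ := Nat.exists_eq_add_of_le' hj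
  rw [Finset.sum_range_succ', Finset.sum_range_succ' (n := j)]
  simp only [Nat.reduceSubDiff, tsub_le_iff_right, tsub_zero, Order.add_one_le_iff, hQlead, hGlead,
    one_mul, tsub_self, zero_le, ↓reduceIte, mul_one, le_add_iff_nonneg_left, true_and,
    nonpos_iff_eq_zero, one_ne_zero, false_and, add_zero]
  ring

end Residues

section MonicOf

variable {A B : Type*} [CommRing A] [CommRing B] {k : ℕ}

/-- The monic polynomial of degree `k` with lower coefficients `c`. -/
noncomputable def monicOf (c : Fin k → A) : A[X] :=
  X ^ k + ∑ i : Fin k, C (c i) * X ^ (i : ℕ)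

theorem monic_monicOf (c : Fin k → A) : (monicOf c).Monic :=
  monic_X_pow_add (degree_sum_fin_lt c)

theorem natDegree_monicOf [Nontrivial A] (c : Fin k → A) : (monicOf c).natDegree = k := by
  have hdeg := degree_sum_fin_lt c
  rw [monicOf, natDegree_add_eq_left_of_degree_lt (by rwa [degree_X_pow]), natDegree_X_pow]

theorem coeff_monicOf (c : Fin k → A) (i : Fin k) : (monicOf c).coeff i = c i := by
  simp [monicOf, finsetSum_coeff, coeff_X_pow, Fin.val_inj, i.2.ne]

theorem map_monicOf (φ : A →+* B) (c : Fin k → A) : (monicOf c).map φ = monicOf (φ ∘ c) := by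
  simp [monicOf, Polynomial.map_sum]

theorem coeffDer_monicOf (D : Derivation ℤ A A) (c : Fin k → A) :
    coeffDer D (monicOf c) = ∑ i : Fin k, C (D (c i)) * X ^ (i : ℕ) := by
  simp only [monicOf, map_add, map_sum, Derivation.leibniz, coeffDer_X_pow, coeffDer_C, smul_eq_mul,
    mul_zero, zero_add, mul_comm (X ^ _)]

end MonicOf

/-! ### The ring of germs and the multiplication map -/

section GermRing

variable {ι : Type*} [Fintype ι]

/-- The value of a germ at the origin. -/
noncomputable def valueHom : germRing ι →+* ℂ := Filter.Germ.valueRingHom.comp (germRing ι).subtype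

theorem valueHom_coord (i : ι) : valueHom (coord i) = 0 := rfl

instance : Nontrivial (germRing ι) := (valueHom (ι := ι)).domain_nontrivial

theorem isUnit_natCast_succ (k : ℕ) : IsUnit ((k + 1 : ℕ) : germRing ι) := by
  refine IsUnit.of_mul_eq_one (germOf (fun _ => ((k + 1 : ℕ) : ℂ)⁻¹) analyticAt_const) ?_
  refine Subtype.ext ?_
  rw [Subring.coe_mul, Subring.coe_natCast, Subring.coe_one]
  exact Filter.Germ.coe_eq.2 <| .of_forall fun _ =>
    mul_inv_cancel₀ (Nat.cast_ne_zero.2 k.succ_ne_zero)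

theorem exists_germOf (φ : germRing ι) : ∃ f, ∃ hf : AnalyticAt ℂ f 0, germOf f hf = φ := by
  obtain ⟨_, f, hf, rfl⟩ := φ
  exact ⟨f, hf, rfl⟩

theorem germOf_eq {f g : (ι → ℂ) → ℂ} (hf : AnalyticAt ℂ f 0) (hg : AnalyticAt ℂ g 0)
    (h : f =ᶠ[𝓝 0] g) : germOf f hf = germOf g hg :=
  Subtype.ext (Filter.Germ.coe_eq.2 h)

theorem eventually_differentiableAt {f : (ι → ℂ) → ℂ} (hf : AnalyticAt ℂ f 0) :
    ∀ᶠ x in 𝓝 0, DifferentiableAt ℂ f x :=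
  hf.eventually_analyticAt.mono fun _ h => h.differentiableAt

variable [DecidableEq ι]

theorem analyticAt_fderiv_apply {f : (ι → ℂ) → ℂ} (hf : AnalyticAt ℂ f 0) (i : ι) :
    AnalyticAt ℂ (fun x => fderiv ℂ f x (Pi.single i 1)) 0 :=
  (ContinuousLinearMap.analyticAt (ContinuousLinearMap.apply ℂ ℂ (Pi.single i (1 : ℂ) : ι → ℂ))
    (fderiv ℂ f 0)).comp hf.fderiv

theorem pderiv_add (i : ι) (φ ψ : germRing ι) : pderiv i (φ + ψ) = pderiv i φ + pderiv i ψ := by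
  obtain ⟨f, hf, rfl⟩ := exists_germOf φ
  obtain ⟨g, hg, rfl⟩ := exists_germOf ψ
  refine germOf_eq (analyticAt_fderiv_apply (hf.add hg) i)
    ((analyticAt_fderiv_apply hf i).add (analyticAt_fderiv_apply hg i)) ?_
  filter_upwards [eventually_differentiableAt hf, eventually_differentiableAt hg] with x h1 h2
  rw [fderiv_add h1 h2]
  rfl

theorem pderiv_mul (i : ι) (φ ψ : germRing ι) :
    pderiv i (φ * ψ) = φ * pderiv i ψ + ψ * pderiv i φ := by
  obtain ⟨f, hf, rfl⟩ := exists_germOf φ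
  obtain ⟨g, hg, rfl⟩ := exists_germOf ψ
  refine germOf_eq (analyticAt_fderiv_apply (hf.mul hg) i)
    ((hf.mul (analyticAt_fderiv_apply hg i)).add (hg.mul (analyticAt_fderiv_apply hf i))) ?_
  filter_upwards [eventually_differentiableAt hf, eventually_differentiableAt hg] with x h1 h2
  rw [fderiv_mul h1 h2]
  rfl

theorem pderiv_coord (i j : ι) : pderiv i (coord j) = if i = j then 1 else 0 := by
  have h : ∀ x : ι → ℂ, fderiv ℂ (fun x : ι → ℂ => x j) x (Pi.single i 1) =
      if i = j then 1 else 0 := by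
    intro x
    rw [show (fun x : ι → ℂ => x j) =
      ContinuousLinearMap.proj (R := ℂ) (φ := fun _ : ι => ℂ) j from rfl,
    ContinuousLinearMap.fderiv]
    simp [Pi.single_apply, eq_comm]
  have hj : AnalyticAt ℂ (fun x : ι → ℂ => x j) 0 :=
    (ContinuousLinearMap.proj (R := ℂ) (φ := fun _ : ι => ℂ) j).analyticAt 0
  split_ifs with hij
  · refine germOf_eq (analyticAt_fderiv_apply hj i) (analyticAt_const (v := (1 : ℂ)))
      (Filter.Eventually.of_forall fun x => ?_)
    simp only [h, if_pos hij]
  · refine germOf_eq (analyticAt_fderiv_apply hj i) (analyticAt_const (v := (0 : ℂ)))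
      (Filter.Eventually.of_forall fun x => ?_)
    simp only [h, if_neg hij]

/-- The partial derivative as a derivation of the ring of germs. -/
noncomputable def pder (i : ι) : Derivation ℤ (germRing ι) (germRing ι) :=
  Derivation.mk' (AddMonoidHom.mk' (pderiv i) (pderiv_add i)).toIntLinearMap (pderiv_mul i)

theorem pder_apply (i : ι) (φ : germRing ι) : pder i φ = pderiv i φ := rfl

theorem jacobianExt_eq_jacExt (k : ℕ) (J : Ideal (germRing ι)) :
    jacobianExt k J = jacExt pder k J := rfl

theorem criticalOrder_eq {J : Ideal (germRing ι)} {k : ℕ} (h1 : jacobianExt k J = ⊤)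
    (h2 : jacobianExt (k + 1) J ≠ ⊤) : criticalOrder J = k + 1 := by
  refine le_antisymm (Nat.sInf_le h2) (le_csInf ⟨_, h2⟩ fun l hl => ?_)
  by_contra! hlk
  have hle : jacobianExt k J ≤ jacobianExt l J := by
    simpa only [jacobianExt_eq_jacExt] using jacExt_antitone pder J (Nat.le_of_lt_succ hlk)
  exact hl (top_le_iff.1 (h1 ▸ hle))

end GermRing

section Multiplication

variable (n r : ℕ)

/-- The polynomial `f` over the ring of germs, whose lower coefficients are the coordinates
`a_0, …, a_{n-1}`. -/
noncomputable def fGerm : (germRing (Fin n ⊕ Fin r))[X] := monicOf (coord ∘ Sum.inl)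

/-- The polynomial `g` over the ring of germs, whose lower coefficients are the coordinates
`b_0, …, b_{r-1}`. -/
noncomputable def gGerm : (germRing (Fin n ⊕ Fin r))[X] := monicOf (coord ∘ Sum.inr)

theorem monic_fGerm : (fGerm n r).Monic := monic_monicOf _

theorem monic_gGerm : (gGerm n r).Monic := monic_monicOf _

theorem natDegree_fGerm : (fGerm n r).natDegree = n := natDegree_monicOf _

theorem natDegree_gGerm : (gGerm n r).natDegree = r := natDegree_monicOf _

theorem map_valueHom_fGerm : (fGerm n r).map valueHom = X ^ n := by
  rw [fGerm, map_monicOf]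
  simp [monicOf, valueHom_coord]

theorem map_valueHom_gGerm : (gGerm n r).map valueHom = X ^ r := by
  rw [gGerm, map_monicOf]
  simp [monicOf, valueHom_coord]

theorem coeffDer_inl_fGerm (l : Fin n) :
    coeffDer (pder (Sum.inl l)) (fGerm n r) = X ^ (l : ℕ) := by
  simp [fGerm, coeffDer_monicOf, pder_apply, pderiv_coord, apply_ite C, ite_mul]

theorem coeffDer_inl_gGerm (l : Fin n) : coeffDer (pder (Sum.inl l)) (gGerm n r) = 0 := by
  simp [gGerm, coeffDer_monicOf, pder_apply, pderiv_coord]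

theorem coeffDer_inr_fGerm (j : Fin r) : coeffDer (pder (Sum.inr j)) (fGerm n r) = 0 := by
  simp [fGerm, coeffDer_monicOf, pder_apply, pderiv_coord]

theorem coeffDer_inr_gGerm (j : Fin r) :
    coeffDer (pder (Sum.inr j)) (gGerm n r) = X ^ (j : ℕ) := by
  simp [gGerm, coeffDer_monicOf, pder_apply, pderiv_coord, apply_ite C, ite_mul]

theorem germOf_mulMap (j : Fin (n + r)) :
    germOf (fun p => mulMap n r p j) (analyticAt_mulMap n r j) =
      (fGerm n r * gGerm n r).coeff j := by
  -- Both sides are the image of the same coefficient over the ring of all functions of `(a, b)`.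
  let R := (Fin n ⊕ Fin r → ℂ) → ℂ
  let F : R[X] := monicOf fun (i : Fin n) p => p (Sum.inl i)
  let G : R[X] := monicOf fun (i : Fin r) p => p (Sum.inr i)
  let κ : R →+* Filter.Germ (𝓝 (0 : Fin n ⊕ Fin r → ℂ)) ℂ := Filter.Germ.coeRingHom _
  have hval : (fun p => mulMap n r p j) = (F * G).coeff j := by
    funext p
    have hF : F.map (Pi.evalRingHom _ p) = fPoly n r p := map_monicOf _ _
    have hG : G.map (Pi.evalRingHom _ p) = gPoly n r p := map_monicOf _ _
    rw [mulMap, ← hF, ← hG, ← Polynomial.map_mul, coeff_map, Pi.evalRingHom_apply]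
  have hF : F.map κ = (fGerm n r).map (germRing _).subtype := by
    rw [fGerm, map_monicOf, map_monicOf]
    rfl
  have hG : G.map κ = (gGerm n r).map (germRing _).subtype := by
    rw [gGerm, map_monicOf, map_monicOf]
    rfl
  refine Subtype.ext ?_
  change κ (fun p => mulMap n r p j) = (germRing _).subtype _
  rw [hval, ← coeff_map, Polynomial.map_mul, hF, hG, ← Polynomial.map_mul, coeff_map]

/-- The ideal of the conditions `f g = x ^ (n + r)` and `g ^ s ∣ f`, which turns out to be the
`s`-th critical extension of `I(μ_{n,r})`. -/
noncomputable def powDvdIdeal (s : ℕ) : Ideal (germRing (Fin n ⊕ Fin r)) :=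
  divIdeal (n + r) (fGerm n r) (gGerm n r) s

theorem mulIdeal_eq_powDvdIdeal : mulIdeal n r = powDvdIdeal n r 0 := by
  have hdeg : (fGerm n r * gGerm n r).natDegree = n + r := by
    rw [(monic_fGerm n r).natDegree_mul (monic_gGerm n r), natDegree_fGerm, natDegree_gGerm]
  rw [powDvdIdeal, divIdeal_zero, contentIdeal_sub_X_pow ((monic_fGerm n r).mul (monic_gGerm n r))
    hdeg, mulIdeal]
  simp only [germOf_mulMap]

theorem powDvdIdeal_ne_top {s : ℕ} (hs : s * r ≤ n) : powDvdIdeal n r s ≠ ⊤ :=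
  divIdeal_ne_top (monic_gGerm n r) (map_valueHom_fGerm n r) (map_valueHom_gGerm n r) hs

theorem jacobianExt_powDvdIdeal_eq_top (s : ℕ) : jacobianExt n (powDvdIdeal n r s) = ⊤ := by
  rw [jacobianExt_eq_jacExt]
  exact jacExt_divIdeal_eq_top pder (coeffDer_inl_fGerm n r) (coeffDer_inl_gGerm n r)
    (monic_gGerm n r)

theorem card_coordinates : Fintype.card (Fin n ⊕ Fin r) = n + r := by
  rw [Fintype.card_sum, Fintype.card_fin, Fintype.card_fin]

variable {r} (hr : 1 ≤ r)
include hr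

theorem jacobianExt_powDvdIdeal (s : ℕ) :
    jacobianExt (n + 1) (powDvdIdeal n r s) = powDvdIdeal n r (s + 1) := by
  have hβG : coeffDer (pder (Sum.inr ⟨0, hr⟩)) (gGerm n r) = 1 := coeffDer_inr_gGerm n r ⟨0, hr⟩
  rw [jacobianExt_eq_jacExt]
  exact jacExt_divIdeal pder (coeffDer_inl_fGerm n r) (coeffDer_inl_gGerm n r)
    (coeffDer_inr_fGerm n r _) hβG (monic_fGerm n r) (monic_gGerm n r) (natDegree_fGerm n r)
    (isUnit_natCast_succ s)

theorem upperExt_powDvdIdeal (s : ℕ) :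
    upperExt r (powDvdIdeal n r s) = powDvdIdeal n r (s + 1) := by
  rw [upperExt, card_coordinates, show n + r + 1 - r = n + 1 by omega,
    jacobianExt_powDvdIdeal n hr]

theorem iterate_upperExt_mulIdeal (s : ℕ) :
    (upperExt r)^[s] (mulIdeal n r) = powDvdIdeal n r s := by
  induction s with
  | zero => exact mulIdeal_eq_powDvdIdeal n r
  | succ s ih => rw [Function.iterate_succ_apply', ih, upperExt_powDvdIdeal n hr]

variable {n}

theorem isCritical_powDvdIdeal {s : ℕ} (hs : (s + 1) * r ≤ n) :
    IsCritical r (powDvdIdeal n r s) := by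
  refine ⟨by rw [card_coordinates]; omega, ?_, ?_⟩
  · rw [upperExt_powDvdIdeal n hr]
    exact powDvdIdeal_ne_top n r hs
  · rw [card_coordinates, Nat.add_sub_cancel]
    exact jacobianExt_powDvdIdeal_eq_top n r s

theorem criticalOrder_powDvdIdeal {s : ℕ} (hs : (s + 1) * r ≤ n) :
    criticalOrder (powDvdIdeal n r s) = n + 1 := by
  refine criticalOrder_eq (jacobianExt_powDvdIdeal_eq_top n r s) ?_
  rw [jacobianExt_powDvdIdeal n hr]
  exact powDvdIdeal_ne_top n r hs

theorem iterate_criticalExt_mulIdeal {s : ℕ} (hs : s * r ≤ n) :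
    criticalExt^[s] (mulIdeal n r) = powDvdIdeal n r s := by
  induction s with
  | zero => exact mulIdeal_eq_powDvdIdeal n r
  | succ s ih =>
    rw [Function.iterate_succ_apply', ih ((Nat.mul_le_mul_right r s.le_succ).trans hs), criticalExt,
      criticalOrder_powDvdIdeal hr hs, jacobianExt_powDvdIdeal n hr]

theorem thomBoardman_mulIdeal {s : ℕ} (hs : (s + 1) * r ≤ n) :
    thomBoardman (mulIdeal n r) s = r := by
  rw [thomBoardman, iterate_criticalExt_mulIdeal hr ((Nat.mul_le_mul_right r s.le_succ).trans hs),
    criticalOrder_powDvdIdeal hr hs, card_coordinates]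
  omega

end Multiplication

/-! ### The sequence `ψ` as residues -/

section Psi

variable (n r : ℕ)

theorem aGerm_eq_coeff {i : ℕ} (hi : i < n) : aGerm n r i = (fGerm n r).coeff i :=
  (dif_pos hi).trans (coeff_monicOf (coord ∘ Sum.inl) ⟨i, hi⟩).symm

theorem bGerm_eq_coeff {j : ℕ} (hj : j < r) : bGerm n r j = (gGerm n r).coeff j :=
  (dif_pos hj).trans (coeff_monicOf (coord ∘ Sum.inr) ⟨j, hj⟩).symm

theorem dRev_eq_coeff {j : ℕ} (hj : 1 ≤ j) (hjn : j ≤ n) :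
    dRev n r j = ((X ^ r * fGerm n r) /ₘ gGerm n r).coeff (n - j) := by
  induction j using Nat.strong_induction_on with
  | _ j ih =>
  have hstep : ∀ i < j, 1 ≤ i → j - i ≤ r → dRev n r i * bGerm n r (r - (j - i)) =
      ((X ^ r * fGerm n r) /ₘ gGerm n r).coeff (n - i) * (gGerm n r).coeff (r - (j - i)) :=
    fun i hi hi1 _ => by rw [ih i hi hi1 (by omega), bGerm_eq_coeff n r (by omega)]
  rw [dRev, coeff_divByMonic_rec (monic_gGerm n r) (monic_fGerm n r) (natDegree_gGerm n r)
    (natDegree_fGerm n r) hj hjn, aGerm_eq_coeff n r (by omega), Finset.sum_range]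
  congr 1
  · refine congrArg _ (ite_congr rfl (fun _ => bGerm_eq_coeff n r (by omega)) fun _ => rfl)
  · exact Finset.sum_congr rfl fun i _ =>
      ite_congr rfl (fun h => hstep i i.2 h.1 h.2) fun _ => rfl

theorem d_eq_res (hrn : r ≤ n) {i : ℕ} (hi : i < r) :
    d n r i = res (gGerm n r) 1 (fGerm n r * X ^ (r - 1 - i)) := by
  have hX : X ^ r * fGerm n r = X ^ (i + 1) * (fGerm n r * X ^ (r - 1 - i)) := by
    rw [mul_left_comm, ← pow_add, show i + 1 + (r - 1 - i) = r by omega, mul_comm]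
  have hdeg := natDegree_gGerm n r
  rw [d, dRev_eq_coeff n r (by omega) (by omega), show n - (n - i) = i by omega, hX,
    coeff_X_pow_mul_divByMonic (monic_gGerm n r) (by omega)]

theorem pderivB_eq_pder {j : ℕ} (hj : j < r) :
    pderivB n r j = pder (Sum.inr ⟨j, hj⟩ : Fin n ⊕ Fin r) :=
  funext fun _ => dif_pos hj

theorem pderivB_res {j : ℕ} (hj : j < r) (s k : ℕ) :
    pderivB n r j (res (gGerm n r) (s + 1) (fGerm n r * X ^ k)) =
      -((s + 1 : ℕ) : germRing (Fin n ⊕ Fin r)) *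
        res (gGerm n r) (s + 2) (fGerm n r * X ^ (k + j)) := by
  have hdeg : 0 < (gGerm n r).natDegree := (natDegree_gGerm n r).symm ▸ j.zero_le.trans_lt hj
  rw [pderivB_eq_pder n r hj, der_res _ (monic_gGerm n r) hdeg, Derivation.leibniz, coeffDer_X_pow,
    coeffDer_inr_fGerm, coeffDer_inr_gGerm, smul_zero, smul_zero, add_zero, map_zero, zero_sub,
    mul_assoc, ← pow_add, neg_mul]

theorem iterate_pderivB_res (hr : 1 ≤ r) {j : ℕ} (hj : j < r) (t : ℕ) :
    (pderivB n r 0)^[t] (pderivB n r j (res (gGerm n r) 1 (fGerm n r))) =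
      ((-1) ^ (t + 1) * (t + 1).factorial : ℤ) • res (gGerm n r) (t + 2) (fGerm n r * X ^ j) := by
  induction t with
  | zero => simpa using pderivB_res n r hj 0 0
  | succ t ih =>
    rw [Function.iterate_succ_apply', ih, pderivB_eq_pder n r hr, map_zsmul,
      ← pderivB_eq_pder n r hr, pderivB_res n r hr, add_zero, Nat.factorial_succ (t + 1),
      zsmul_eq_mul, zsmul_eq_mul]
    push_cast
    ring

theorem psi_eq_zsmul_res (hrn : r ≤ n) {i : ℕ} (hi : i < r) (t : ℕ) :
    psi n r (t * r + i) = ((-1) ^ t * t.factorial : ℤ) •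
      res (gGerm n r) (t + 1) (fGerm n r * X ^ (r - 1 - i)) := by
  have hr : 0 < r := i.zero_le.trans_lt hi
  rcases t with _ | t
  · rw [psi, zero_mul, zero_add, if_pos hi, d_eq_res n r hrn hi]
    simp
  · have hge : ¬ (t + 1) * r + i < r := by
      rw [add_one_mul]
      omega
    have hdiv : ((t + 1) * r + i) / r = t + 1 := by
      rw [mul_comm, Nat.mul_add_div hr, Nat.div_eq_of_lt hi, add_zero]
    have hmod : ((t + 1) * r + i) % r = i := by
      rw [Nat.mul_add_mod_self_right, Nat.mod_eq_of_lt hi]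
    have hd : d n r (r - 1) = res (gGerm n r) 1 (fGerm n r) := by
      rw [d_eq_res n r hrn (by omega), Nat.sub_self, pow_zero, mul_one]
    rw [psi, if_neg hge, hdiv, hmod, hd, Nat.add_sub_cancel, iterate_pderivB_res n r hr (by omega)]

theorem isUnit_neg_one_pow_mul_factorial (t : ℕ) :
    IsUnit (((-1) ^ t * t.factorial : ℤ) : germRing (Fin n ⊕ Fin r)) := by
  obtain ⟨k, hk⟩ := Nat.exists_eq_add_of_le' t.factorial_pos
  rw [Int.cast_mul, Int.cast_pow, Int.cast_neg, Int.cast_one, Int.cast_natCast, hk]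
  exact (isUnit_one.neg.pow t).mul (isUnit_natCast_succ k)

variable {n r} {K : Ideal (germRing (Fin n ⊕ Fin r))}

theorem psi_mem_iff (hrn : r ≤ n) {i : ℕ} (hi : i < r) (t : ℕ) :
    psi n r (t * r + i) ∈ K ↔
      res (gGerm n r) (t + 1) (fGerm n r * X ^ (r - 1 - i)) ∈ K := by
  rw [psi_eq_zsmul_res n r hrn hi, zsmul_eq_mul,
    Ideal.unit_mul_mem_iff_mem _ (isUnit_neg_one_pow_mul_factorial n r t)]

theorem forall_psi_mem_iff (hr : 1 ≤ r) (hrn : r ≤ n) (s : ℕ) :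
    (∀ l < s * r, psi n r l ∈ K) ↔
      ∀ t < s, ∀ i < r, res (gGerm n r) (t + 1) (fGerm n r * X ^ i) ∈ K := by
  constructor
  · intro h t ht i hi
    have hlt : t * r + (r - 1 - i) < s * r := by
      have := Nat.mul_le_mul_right r (Nat.succ_le_of_lt ht)
      rw [Nat.succ_mul] at this
      omega
    have hmem := (psi_mem_iff hrn (by omega) t).1 (h _ hlt)
    rwa [show r - 1 - (r - 1 - i) = i by omega] at hmem
  · intro h l hl
    have hmem := (psi_mem_iff hrn (Nat.mod_lt l hr) (l / r)).2
      (h _ ((Nat.div_lt_iff_lt_mul hr).2 hl) _ (by omega))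
    rwa [Nat.div_add_mod'] at hmem

theorem forall_psi_mem_iff_pow_dvd (hr : 1 ≤ r) (hrn : r ≤ n) (s : ℕ) :
    (∀ l < s * r, psi n r l ∈ K) ↔
      (gGerm n r).map (Ideal.Quotient.mk K) ^ s ∣ (fGerm n r).map (Ideal.Quotient.mk K) := by
  have hdeg := natDegree_gGerm n r
  rw [forall_psi_mem_iff hr hrn, ← forall_map_res_eq_zero_iff_pow_dvd (monic_gGerm n r) (by omega),
    hdeg]
  simp only [Ideal.Quotient.eq_zero_iff_mem]

theorem powDvdIdeal_eq_sup_span_psi (hr : 1 ≤ r) (hrn : r ≤ n) (s : ℕ) :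
    powDvdIdeal n r s = mulIdeal n r ⊔ Ideal.span {φ | ∃ l : ℕ, l < s * r ∧ φ = psi n r l} := by
  refine eq_of_forall_ge_iff fun K => ?_
  have hpsi : Ideal.span {φ | ∃ l : ℕ, l < s * r ∧ φ = psi n r l} ≤ K ↔
      ∀ l < s * r, psi n r l ∈ K := by
    rw [Ideal.span_le]
    exact ⟨fun h l hl => h ⟨l, hl, rfl⟩, fun h _ ⟨l, hl, hφ⟩ => hφ ▸ h l hl⟩
  have hle : ∀ t, powDvdIdeal n r t ≤ K ↔
      powDvdIdeal n r t ≤ RingHom.ker (Ideal.Quotient.mk K) := by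
    rw [Ideal.mk_ker]
    exact fun _ => Iff.rfl
  rw [sup_le_iff, mulIdeal_eq_powDvdIdeal, hpsi, forall_psi_mem_iff_pow_dvd hr hrn, hle, hle]
  simp only [powDvdIdeal, divIdeal_le_ker_iff (monic_gGerm n r), pow_zero, one_dvd, and_true]

end Psi

end ThomBoardman

theorem theorem3p6 (n r q₁ r₁ : ℕ) (hr : 1 ≤ r) (hrn : r ≤ n)
    (hdiv : n = q₁ * r + r₁) (hr₁ : r₁ < r) :
    (∀ s : ℕ, 1 ≤ s → s ≤ q₁ →
      (ThomBoardman.upperExt r)^[s] (ThomBoardman.mulIdeal n r) =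
        ThomBoardman.mulIdeal n r ⊔
          Ideal.span {φ | ∃ l : ℕ, l < s * r ∧ φ = ThomBoardman.psi n r l}) ∧
    (∀ s : ℕ, s < q₁ → ThomBoardman.IsCritical r
      ((ThomBoardman.upperExt r)^[s] (ThomBoardman.mulIdeal n r))) ∧
    (∀ s : ℕ, s < q₁ → ThomBoardman.thomBoardman (ThomBoardman.mulIdeal n r) s = r) := by
  have hle : ∀ s < q₁, (s + 1) * r ≤ n := fun s hs => by
    rw [hdiv]
    exact (Nat.mul_le_mul_right r hs).trans (Nat.le_add_right _ _)
  have hiter := ThomBoardman.iterate_upperExt_mulIdeal n hr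
  refine ⟨fun s _ _ => ?_, fun s hs => ?_, fun s hs => ?_⟩
  · rw [hiter, ThomBoardman.powDvdIdeal_eq_sup_span_psi hr hrn]
  · rw [hiter]
    exact ThomBoardman.isCritical_powDvdIdeal hr (hle s hs)
  · exact ThomBoardman.thomBoardman_mulIdeal hr (hle s hs)
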